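/- Let $n\ge 1$ and let $\Omega\subset\mathbb C^n$ be a domain (a non-empty connected open set, not necessarily bounded). Let $p\in\partial\Omega$ be a $\mathcal C^2$-smooth boundary point: there are an open neighbourhood $W$ of $p$ and a $\mathcal C^2$ function $\rho:W\to\mathbb R$ with $\Omega\cap W=\{z\in W:\rho(z)<0\}$ and $d\rho\neq0$ on $\{\rho=0\}$. For $q\in\partial\Omega\cap W$ let $n_q$ be the inner unit normal to $\partial\Omega$ at $q$, and let $T^{\mathbb C}_q\partial\Omega=\{X\in\mathbb C^n:d\rho_q(X)=d\rho_q(iX)=0\}$ be the complex tangent space. Assume that $\partial\Omega$ is Levi-flat near $p$, i.e. for all $q\in\partial\Omega$ sufficiently close to $p$, $$\sum_{j,k}\frac{\partial^2\rho}{\partial z_j\partial\bar z_k}(q)X_j\overline{X_k}=0\qquad\text{for all }X\in T^{\mathbb C}_q\partial\Omega .$$ Write $\delta_\Omega(z)$ for the Euclidean distance from $z$ to $\partial\Omega$, and let $\mathbb D$ be the unit disc. For $z\in\Omega$ and $X\in\mathbb C^n$ define the Carathéodory and Kobayashi metrics by $$\gamma_\Omega(z;X)=\sup\{|f'(z)X|: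 f\in\mathcal O(\Omega,\mathbb D)\},$$ $$\kappa_\Omega(z;X)=\inf\{|t|: t\in\mathbb C,\ \exists\,\varphi\in\mathcal O(\mathbb D,\Omega)\text{ with }\varphi(0)=z,\ t\varphi'(0)=X\}.$$ Assume in addition that (*) for all $q\in\partial\Omega$ sufficiently close to $p$, $\Omega$ does not intersect the real tangent hyperplane to $\partial\Omega$ at $q$, that is, $\Omega\cap\{w:d\rho_q(w-q)=0\}=\emptyset$. Then there exist a neighbourhood $U_p$ of $p$ and a constant $c_p>0$ such that for every $z\in\Omega\cap U_p$ there is a unique point $p(z)\in\partial\Omega\cap W$ with $z=p(z)+\delta_\Omega(z)\,n_{p(z)}$, and for every $X\in\mathbb C^n$, with the orthogonal decomposition $X=X_N+X_T$, $X_T\in T^{\mathbb C}_{p(z)}\partial\Omega$, and with $\alpha_\Omega$ denoting either $\gamma_\Omega$ or $\kappa_\Omega$, $$0\le\alpha_\Omega(z;X)-\frac{\|X_N\|}{2\,\delta_\Omega(z)}\le c_p\|X\| .$$ Moreover, condition (*) is satisfied whenever $\Omega$ is convex. -/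

import Mathlib

open Set Filter Topology Metric

noncomputable section

/-- The Kobayashi(-Royden) infinitesimal metric of `Ω` at `z` in the direction `X`:
the infimum of `|t|`, `t ∈ ℂ`, such that `t φ'(0) = X` for some holomorphic map `φ` from the
unit disc to `Ω` with `φ(0) = z`. -/
def kobayashiMetric {n : ℕ} (Ω : Set (EuclideanSpace ℂ (Fin n)))
    (z X : EuclideanSpace ℂ (Fin n)) : ℝ :=
  sInf {s : ℝ | ∃ (t : ℂ) (φ : ℂ → EuclideanSpace ℂ (Fin n)),
    DifferentiableOn ℂ φ (ball 0 1) ∧ MapsTo φ (ball 0 1) Ω ∧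
      φ 0 = z ∧ t • deriv φ 0 = X ∧ s = ‖t‖}

/-- The Carathéodory(-Reiffen) infinitesimal metric of `Ω` at `z` in the direction `X`:
the supremum of `|f'(z) X|` over all holomorphic maps `f` from `Ω` to the unit disc. -/
def caratheodoryMetric {n : ℕ} (Ω : Set (EuclideanSpace ℂ (Fin n)))
    (z X : EuclideanSpace ℂ (Fin n)) : ℝ :=
  sSup {s : ℝ | ∃ f : EuclideanSpace ℂ (Fin n) → ℂ,
    DifferentiableOn ℂ f Ω ∧ MapsTo f Ω (ball 0 1) ∧ s = ‖fderiv ℂ f z X‖}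

/-- `δ_Ω(z)`, the Euclidean distance from `z` to the boundary of `Ω`. -/
def boundaryDist {n : ℕ} (Ω : Set (EuclideanSpace ℂ (Fin n)))
    (z : EuclideanSpace ℂ (Fin n)) : ℝ :=
  infDist z (frontier Ω)

/-- `ρ` is a `C²` defining function of `Ω` on the open set `W`: there `Ω` is given by `ρ < 0`,
and `dρ ≠ 0` where `ρ = 0` (so that `∂Ω ∩ W = {z ∈ W | ρ z = 0}`). -/
structure IsC2DefiningFunction {n : ℕ} (Ω W : Set (EuclideanSpace ℂ (Fin n)))
    (ρ : EuclideanSpace ℂ (Fin n) → ℝ) : Prop where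
  isOpen : IsOpen W
  contDiffOn : ContDiffOn ℝ 2 ρ W
  inter_eq : Ω ∩ W = {z | z ∈ W ∧ ρ z < 0}
  fderiv_ne_zero : ∀ z ∈ W, ρ z = 0 → fderiv ℝ ρ z ≠ 0

/-- The real tangent hyperplane at `q` (as an affine hyperplane through `q`) to the
level hypersurface of `ρ`. -/
def realTangentHyperplane {n : ℕ} (ρ : EuclideanSpace ℂ (Fin n) → ℝ)
    (q : EuclideanSpace ℂ (Fin n)) : Set (EuclideanSpace ℂ (Fin n)) :=
  {w | fderiv ℝ ρ q (w - q) = 0}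

/-- The complex tangent space at `q`: the largest complex subspace of the real tangent space,
i.e. the set of those `X` for which both `X` and `iX` are tangent. -/
def complexTangentSpace {n : ℕ} (ρ : EuclideanSpace ℂ (Fin n) → ℝ)
    (q : EuclideanSpace ℂ (Fin n)) : Submodule ℂ (EuclideanSpace ℂ (Fin n)) where
  carrier := {X | fderiv ℝ ρ q X = 0 ∧ fderiv ℝ ρ q (Complex.I • X) = 0}
  zero_mem' := by simp
  add_mem' := by
    rintro X Y ⟨h1, h2⟩ ⟨h3, h4⟩
    constructor
    · rw [map_add, h1, h3, add_zero]
    · rw [smul_add, map_add, h2, h4, add_zero]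
  smul_mem' := by
    rintro c X ⟨h1, h2⟩
    have key : ∀ d : ℂ, fderiv ℝ ρ q (d • X) = 0 := by
      intro d
      have hd : d • X = d.re • X + d.im • (Complex.I • X) := by
        ext i
        simp only [PiLp.smul_apply, PiLp.add_apply, smul_eq_mul, Complex.real_smul]
        conv_lhs => rw [← Complex.re_add_im d]
        ring
      rw [hd, map_add, map_smul, map_smul, h1, h2]
      simp
    exact ⟨key c, by rw [smul_smul]; exact key _⟩

/-- The Levi form of `ρ` at `q`,
`∑ j k, ∂²ρ/∂z_j∂z̄_k (q) X_j (conj X_k) = (D²ρ(q)(X, X) + D²ρ(q)(iX, iX)) / 4`,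
which is also `∂²/∂ζ∂ζ̄` of `ρ (q + ζ X)` at `ζ = 0`. -/
def leviForm {n : ℕ} (ρ : EuclideanSpace ℂ (Fin n) → ℝ)
    (q X : EuclideanSpace ℂ (Fin n)) : ℝ :=
  (fderiv ℝ (fderiv ℝ ρ) q X X +
    fderiv ℝ (fderiv ℝ ρ) q (Complex.I • X) (Complex.I • X)) / 4

/-- The boundary of `Ω` is Levi-flat near `p`: at every boundary point near `p`, the Levi form
(of the defining function `ρ`) vanishes on the complex tangent space. -/
def LeviFlatNear {n : ℕ} (Ω : Set (EuclideanSpace ℂ (Fin n)))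
    (ρ : EuclideanSpace ℂ (Fin n) → ℝ) (p : EuclideanSpace ℂ (Fin n)) : Prop :=
  ∀ᶠ q in 𝓝[frontier Ω] p, ∀ X ∈ complexTangentSpace ρ q, leviForm ρ q X = 0

/-- `Ω` does not meet the real tangent hyperplane to `∂Ω` at any boundary point near `p`. -/
def AvoidsTangentHyperplanesNear {n : ℕ} (Ω : Set (EuclideanSpace ℂ (Fin n)))
    (ρ : EuclideanSpace ℂ (Fin n) → ℝ) (p : EuclideanSpace ℂ (Fin n)) : Prop :=
  ∀ᶠ q in 𝓝[frontier Ω] p, Disjoint Ω (realTangentHyperplane ρ q)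

/-- The inner unit normal vector at `q` of a domain with defining function `ρ`. -/
def innerNormal {n : ℕ} (ρ : EuclideanSpace ℂ (Fin n) → ℝ)
    (q : EuclideanSpace ℂ (Fin n)) : EuclideanSpace ℂ (Fin n) :=
  -(‖gradient ρ q‖⁻¹ • gradient ρ q)

/-- `q` is the point `p(z)`: a boundary point (where `ρ` defines `Ω`) such that
`z = q + δ_Ω(z) n_q`. -/
def IsFootPoint {n : ℕ} (Ω W : Set (EuclideanSpace ℂ (Fin n)))
    (ρ : EuclideanSpace ℂ (Fin n) → ℝ) (z q : EuclideanSpace ℂ (Fin n)) : Prop :=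
  q ∈ frontier Ω ∧ q ∈ W ∧ z = q + boundaryDist Ω z • innerNormal ρ q

/-- The complex normal component `X_N` of `X` at the boundary point `q`: in the orthogonal
decomposition `X = X_N + X_T`, `X_T` lies in the complex tangent space at `q`. -/
def normalComponent {n : ℕ} (ρ : EuclideanSpace ℂ (Fin n) → ℝ)
    (q X : EuclideanSpace ℂ (Fin n)) : EuclideanSpace ℂ (Fin n) :=
  X - (complexTangentSpace ρ q).starProjection X

end

/-! Both metrics are squeezed by the same two competitors. If `f` maps `Ω` to the unit disc and `φ`
is a disc in `Ω` with `φ 0 = z` and `t φ'(0) = X`, the Schwarz lemma for `f ∘ φ` gives `|f'(z) X| ≤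
|t|`. So one function bounds both metrics below and one disc bounds both above.

Lower bound: `Ω` is connected and misses the tangent hyperplane at the foot point `q`, so it lies in
the half-space `Re ⟨ν, w - q⟩ > 0`, where `ν` is the inner normal at `q`. The Cayley transform of
this half-plane coordinate has derivative of modulus exactly `‖X_N‖ / (2δ)`
(`exists_halfSpace_competitor`).

Upper bound: missing the tangent hyperplanes makes the Hessian of `ρ` nonnegative on real tangent
vectors. Levi-flatness says that its values at `X` and `iX` sum to zero for complex tangent `X`, so
both vanish. A null vector of a semidefinite form is in its kernel, and therefore the unit normal
has zero derivative in complex tangential directions (`fderiv_innerNormal_eq_zero`). Integrating,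
the boundary near `p` contains flat pieces of complex hyperplanes, of uniform size `r`, along which
the normal is constant (`exists_flat_leaves`). The interior balls of radius `R` along such a leaf
are translates of one another, so a disc may move linearly along the leaf while its normal
coordinate runs through a planar disc of radius `R`. The resulting cost is at most `‖X_N‖ / (2δ) +
(1 / (2R) + 1 / r) ‖X‖` (`exists_disc_competitor`). -/

theorem Complex.norm_deriv_le_one_of_mapsTo_unitBall {h : ℂ → ℂ}
    (hd : DifferentiableOn ℂ h (ball 0 1)) (hm : MapsTo h (ball 0 1) (ball 0 1)) :
    ‖deriv h 0‖ ≤ 1 := by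
  -- Nothing is known on the unit circle, so Cauchy's estimate is applied at radius `r < 1` and `r`
  -- then tends to 1.
  have key : ∀ r ∈ Ioo (0 : ℝ) 1, r * ‖deriv h 0‖ ≤ 1 := by
    intro r hr
    have hsub : closedBall (0 : ℂ) r ⊆ ball 0 1 := closedBall_subset_ball hr.2
    have := Complex.norm_deriv_le_of_forall_mem_sphere_norm_le (c := 0) (C := 1) (f := h) hr.1
      ((hd.mono hsub).mono closure_ball_subset_closedBall).diffContOnCl (fun z hz => by
        simpa using (mem_ball_zero_iff.1 (hm (hsub (sphere_subset_closedBall hz)))).le)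
    rw [le_div_iff₀ hr.1] at this
    linarith
  have h1 : Tendsto (fun r : ℝ => r * ‖deriv h 0‖) (𝓝[<] 1) (𝓝 (1 * ‖deriv h 0‖)) :=
    ((continuous_id.mul continuous_const).tendsto 1).mono_left nhdsWithin_le_nhds
  rw [one_mul] at h1
  refine le_of_tendsto h1 ?_
  filter_upwards [Ioo_mem_nhdsLT (zero_lt_one' ℝ)] with r hr using key r hr

/-! ### Comparison of the two metrics, and explicit competitors -/

section metrics

variable {n : ℕ} {Ω : Set (EuclideanSpace ℂ (Fin n))}

theorem norm_fderiv_le_norm_of_disc (hΩ : IsOpen Ω) {f : EuclideanSpace ℂ (Fin n) → ℂ}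
    (hf : DifferentiableOn ℂ f Ω) (hfm : MapsTo f Ω (ball 0 1))
    {φ : ℂ → EuclideanSpace ℂ (Fin n)} (hφ : DifferentiableOn ℂ φ (ball 0 1))
    (hφm : MapsTo φ (ball 0 1) Ω) (t : ℂ) :
    ‖fderiv ℂ f (φ 0) (t • deriv φ 0)‖ ≤ ‖t‖ := by
  have h0 : (0 : ℂ) ∈ ball (0 : ℂ) 1 := mem_ball_self one_pos
  have hfd := (hf.differentiableAt (hΩ.mem_nhds (hφm h0))).hasFDerivAt
  have hφd := (hφ.differentiableAt (isOpen_ball.mem_nhds h0)).hasDerivAt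
  have hc : HasDerivAt (f ∘ φ) (fderiv ℂ f (φ 0) (deriv φ 0)) 0 := hfd.comp_hasDerivAt 0 hφd
  have := Complex.norm_deriv_le_one_of_mapsTo_unitBall (hf.comp hφ hφm) (hfm.comp hφm)
  rw [hc.deriv] at this
  rw [map_smul, norm_smul]
  exact mul_le_of_le_one_right (norm_nonneg _) this

theorem kobayashiMetric_le {z X : EuclideanSpace ℂ (Fin n)} {t : ℂ}
    {φ : ℂ → EuclideanSpace ℂ (Fin n)} (hφ : DifferentiableOn ℂ φ (ball 0 1))
    (hφm : MapsTo φ (ball 0 1) Ω) (hz : φ 0 = z) (hX : t • deriv φ 0 = X) :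
    kobayashiMetric Ω z X ≤ ‖t‖ := by
  refine csInf_le ⟨0, ?_⟩ ⟨t, φ, hφ, hφm, hz, hX, rfl⟩
  rintro _ ⟨t, -, -, -, -, -, rfl⟩
  exact norm_nonneg t

theorem caratheodoryMetric_le (hΩ : IsOpen Ω) {z X : EuclideanSpace ℂ (Fin n)} {t : ℂ}
    {φ : ℂ → EuclideanSpace ℂ (Fin n)} (hφ : DifferentiableOn ℂ φ (ball 0 1))
    (hφm : MapsTo φ (ball 0 1) Ω) (hz : φ 0 = z) (hX : t • deriv φ 0 = X) :
    caratheodoryMetric Ω z X ≤ ‖t‖ := by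
  refine Real.sSup_le ?_ (norm_nonneg t)
  rintro _ ⟨f, hf, hfm, rfl⟩
  rw [← hz, ← hX]
  exact norm_fderiv_le_norm_of_disc hΩ hf hfm hφ hφm t

/-- The disc serves only to bound the set of competing values, without which the real supremum would
be 0 by default. -/
theorem le_caratheodoryMetric (hΩ : IsOpen Ω) {z X : EuclideanSpace ℂ (Fin n)} {t : ℂ}
    {φ : ℂ → EuclideanSpace ℂ (Fin n)} (hφ : DifferentiableOn ℂ φ (ball 0 1))
    (hφm : MapsTo φ (ball 0 1) Ω) (hz : φ 0 = z) (hX : t • deriv φ 0 = X)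
    {f : EuclideanSpace ℂ (Fin n) → ℂ} (hf : DifferentiableOn ℂ f Ω)
    (hfm : MapsTo f Ω (ball 0 1)) :
    ‖fderiv ℂ f z X‖ ≤ caratheodoryMetric Ω z X := by
  refine le_csSup ⟨‖t‖, ?_⟩ ⟨f, hf, hfm, rfl⟩
  rintro _ ⟨f, hf, hfm, rfl⟩
  rw [← hz, ← hX]
  exact norm_fderiv_le_norm_of_disc hΩ hf hfm hφ hφm t

/-- Here the given disc makes the set of competing values nonempty; the infimum of the empty set
would be 0. -/
theorem le_kobayashiMetric (hΩ : IsOpen Ω) {z X : EuclideanSpace ℂ (Fin n)} {t : ℂ}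
    {φ : ℂ → EuclideanSpace ℂ (Fin n)} (hφ : DifferentiableOn ℂ φ (ball 0 1))
    (hφm : MapsTo φ (ball 0 1) Ω) (hz : φ 0 = z) (hX : t • deriv φ 0 = X)
    {f : EuclideanSpace ℂ (Fin n) → ℂ} (hf : DifferentiableOn ℂ f Ω)
    (hfm : MapsTo f Ω (ball 0 1)) :
    ‖fderiv ℂ f z X‖ ≤ kobayashiMetric Ω z X := by
  refine le_csInf ⟨‖t‖, t, φ, hφ, hφm, hz, hX, rfl⟩ ?_
  rintro _ ⟨t, φ, hφ, hφm, rfl, rfl, rfl⟩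
  exact norm_fderiv_le_norm_of_disc hΩ hf hfm hφ hφm t

theorem norm_sub_lt_norm_add {u : ℂ} {δ : ℝ} (hδ : 0 < δ) (hu : 0 < u.re) :
    ‖u - δ‖ < ‖u + δ‖ := by
  rw [← sq_lt_sq₀ (norm_nonneg _) (norm_nonneg _), ← Complex.normSq_eq_norm_sq,
    ← Complex.normSq_eq_norm_sq, Complex.normSq_apply, Complex.normSq_apply]
  simp only [Complex.sub_re, Complex.sub_im, Complex.add_re, Complex.add_im, Complex.ofReal_re,
    Complex.ofReal_im]
  nlinarith [mul_pos hδ hu]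

theorem norm_sub_lt_norm_one_sub_mul {ζ : ℂ} {b : ℝ} (hb : |b| < 1) (hζ : ‖ζ‖ < 1) :
    ‖ζ - b‖ < ‖1 - b * ζ‖ := by
  have h1 : ζ.re * ζ.re + ζ.im * ζ.im < 1 := by
    rw [← Complex.normSq_apply, Complex.normSq_eq_norm_sq]
    exact pow_lt_one₀ (norm_nonneg _) hζ two_ne_zero
  have h2 : b ^ 2 < 1 := (sq_lt_one_iff_abs_lt_one b).2 hb
  rw [← sq_lt_sq₀ (norm_nonneg _) (norm_nonneg _), ← Complex.normSq_eq_norm_sq,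
    ← Complex.normSq_eq_norm_sq, Complex.normSq_apply, Complex.normSq_apply]
  simp only [Complex.sub_re, Complex.sub_im, Complex.ofReal_re, Complex.ofReal_im, Complex.one_re,
    Complex.one_im, Complex.mul_re, Complex.mul_im]
  nlinarith [mul_pos (sub_pos.2 h1) (sub_pos.2 h2)]

/-- The automorphism of the half-plane onto the disc, precomposed with a complex linear form, is a
competitor for the Carathéodory metric of a domain lying in a half-space. -/
theorem exists_halfSpace_competitor {q ν : EuclideanSpace ℂ (Fin n)} (hν : ‖ν‖ = 1) {δ : ℝ}
    (hδ : 0 < δ) (hH : ∀ w ∈ Ω, 0 < (inner ℂ ν (w - q)).re) :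
    ∃ f : EuclideanSpace ℂ (Fin n) → ℂ, DifferentiableOn ℂ f Ω ∧ MapsTo f Ω (ball 0 1) ∧
      ∀ X, ‖fderiv ℂ f (q + δ • ν) X‖ = ‖inner ℂ ν X‖ / (2 * δ) := by
  have hδ' : (δ : ℂ) ≠ 0 := by exact_mod_cast hδ.ne'
  have hl : ∀ w, HasFDerivAt (fun w => inner ℂ ν (w - q)) (innerSL ℂ ν) w := fun w =>
    (innerSL ℂ ν).hasFDerivAt.comp w ((hasFDerivAt_id w).sub_const q)
  have hm : ∀ u : ℂ, u + δ ≠ 0 →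
      HasDerivAt (fun u : ℂ => (u - δ) / (u + δ)) (2 * δ / (u + δ) ^ 2) u := by
    intro u hu
    refine (((hasDerivAt_id u).sub_const (δ : ℂ)).div ((hasDerivAt_id u).add_const (δ : ℂ))
      hu).congr_deriv ?_
    simp only [id]
    ring
  have hne : ∀ u : ℂ, 0 < u.re → u + δ ≠ 0 := by
    intro u hu h
    have := congrArg Complex.re h
    simp at this
    linarith
  refine ⟨(fun u : ℂ => (u - δ) / (u + δ)) ∘ fun w => inner ℂ ν (w - q), ?_, ?_, ?_⟩
  · intro w hw
    exact ((hm _ (hne _ (hH w hw))).comp_hasFDerivAt w (hl w)).differentiableAt.differentiableWithinAt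
  · intro w hw
    have := hH w hw
    rw [mem_ball_zero_iff, Function.comp_apply, norm_div, div_lt_one]
    · exact norm_sub_lt_norm_add hδ this
    · exact norm_pos_iff.2 (hne _ this)
  · intro X
    have hu : inner ℂ ν (q + δ • ν - q) = (δ : ℂ) := by
      rw [add_sub_cancel_left, ← Complex.coe_smul, inner_smul_right, inner_self_eq_norm_sq_to_K, hν]
      simp
    have h := (hm (inner ℂ ν (q + δ • ν - q)) (by rw [hu]; simpa using hδ')).comp_hasFDerivAt
      (q + δ • ν) (hl _)
    rw [h.fderiv, hu]
    have : (2 * δ / (δ + δ) ^ 2 : ℂ) = ((1 / (2 * δ) : ℝ) : ℂ) := by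
      push_cast; field_simp; ring
    rw [this]
    simp [abs_of_pos hδ]
    field_simp

/-- A disc through `q + δ ν` in direction `X`, inside the union of the balls of radius `R`
tangent at the points of a complex disc through `q` orthogonal to `ν`. -/
theorem exists_disc_competitor {q ν : EuclideanSpace ℂ (Fin n)} (hν : ‖ν‖ = 1)
    {δ R r : ℝ} (hδ : 0 < δ) (hδR : δ ≤ R) (hr : 0 < r)
    (hB : ∀ a : EuclideanSpace ℂ (Fin n), inner ℂ ν a = 0 → ‖a‖ ≤ r →
      ball (q + a + R • ν) R ⊆ Ω) (X : EuclideanSpace ℂ (Fin n)) :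
    ∃ (t : ℂ) (φ : ℂ → EuclideanSpace ℂ (Fin n)), DifferentiableOn ℂ φ (ball 0 1) ∧
      MapsTo φ (ball 0 1) Ω ∧ φ 0 = q + δ • ν ∧ t • deriv φ 0 = X ∧
      ‖t‖ ≤ ‖inner ℂ ν X‖ / (2 * δ) + (1 / (2 * R) + 1 / r) * ‖X‖ := by
  have hR : 0 < R := hδ.trans_le hδR
  set x : ℂ := inner ℂ ν X with hx
  set T : EuclideanSpace ℂ (Fin n) := X - x • ν with hT
  have hνν : inner ℂ ν ν = (1 : ℂ) := by rw [inner_self_eq_norm_sq_to_K, hν]; simp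
  have hTν : inner ℂ ν T = 0 := by
    rw [hT, inner_sub_right, inner_smul_right, hνν, mul_one, sub_self]
  have hxX : ‖x‖ ≤ ‖X‖ := by simpa [hν] using norm_inner_le_norm (𝕜 := ℂ) ν X
  have hTX : ‖T‖ ≤ ‖X‖ := by
    have h1 : inner ℂ (x • ν) T = 0 := by rw [inner_smul_left, hTν, mul_zero]
    have h2 := norm_add_sq_eq_norm_sq_add_norm_sq_of_inner_eq_zero (x • ν) T h1
    rw [hT, add_sub_cancel, ← hT] at h2
    nlinarith [norm_nonneg X, norm_nonneg T, mul_self_nonneg ‖x • ν‖]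
  -- The Blaschke parameter for which `g ζ = R + R (ζ - b) / (1 - b ζ)` maps the unit disc into the
  -- disc of centre and radius `R`, with `g 0 = δ`. The number `G` below is `g'(0)`.
  set b : ℝ := (R - δ) / R with hb
  have hb0 : 0 ≤ b := div_nonneg (by linarith) hR.le
  have hb1 : b < 1 := by rw [hb, div_lt_one hR]; linarith
  have hRb : R * b = R - δ := by rw [hb]; field_simp
  have hbabs : |b| < 1 := by rwa [abs_of_nonneg hb0]
  set G : ℝ := R * (1 - b ^ 2) with hG
  have hG2 : G = 2 * δ - δ ^ 2 / R := by rw [hG, hb]; field_simp; ring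
  have hGδ : δ ≤ G := by
    have : δ ^ 2 / R ≤ δ := by rw [div_le_iff₀ hR]; nlinarith
    linarith
  have hGpos : 0 < G := hδ.trans_le hGδ
  -- Large enough that both the tangential velocity `T / τ` has norm at most `r` and the rescaling
  -- `η = x / (τ G)` of the argument of `g` has modulus at most 1.
  set τ : ℝ := ‖x‖ / G + ‖T‖ / r with hτ
  have hτ1 : ‖x‖ / G ≤ τ := le_add_of_nonneg_right (by positivity)
  have hτ2 : ‖T‖ / r ≤ τ := le_add_of_nonneg_left (by positivity)
  have hτ0 : 0 ≤ τ := by positivity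
  set a : EuclideanSpace ℂ (Fin n) := (τ : ℂ)⁻¹ • T with ha
  set η : ℂ := (τ : ℂ)⁻¹ * (x / G) with hη
  have hηn : ‖η‖ ≤ 1 := by
    rw [hη, norm_mul, norm_inv, norm_div, Complex.norm_real, Complex.norm_real, Real.norm_eq_abs,
      Real.norm_eq_abs, abs_of_nonneg hτ0, abs_of_pos hGpos]
    exact inv_mul_le_one_of_le₀ hτ1 hτ0
  have han : ‖a‖ ≤ r := by
    rw [ha, norm_smul, norm_inv, Complex.norm_real, Real.norm_eq_abs, abs_of_nonneg hτ0]
    rw [div_le_iff₀ hr] at hτ2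
    calc τ⁻¹ * ‖T‖ ≤ τ⁻¹ * (τ * r) := by gcongr
      _ = (τ⁻¹ * τ) * r := by ring
      _ ≤ 1 * r := by gcongr; exact inv_mul_le_one
      _ = r := one_mul r
  have haν : inner ℂ ν a = 0 := by rw [ha, inner_smul_right, hTν, mul_zero]
  have hden : ∀ ζ : ℂ, ‖ζ‖ < 1 → (1 - b * ζ : ℂ) ≠ 0 := by
    intro ζ hζ h
    have := norm_sub_lt_norm_one_sub_mul hbabs hζ
    rw [h, norm_zero] at this
    exact absurd this (norm_nonneg _).not_gt
  let g : ℂ → ℂ := fun ζ => R + R * ((ζ - b) / (1 - b * ζ))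
  have hgd : ∀ ζ : ℂ, ‖ζ‖ < 1 → HasDerivAt g
      (R * ((1 * (1 - b * ζ) - (ζ - b) * (-(b * 1))) / (1 - b * ζ) ^ 2)) ζ := fun ζ hζ =>
    (((((hasDerivAt_id ζ).sub_const (b : ℂ)).div
      (((hasDerivAt_id ζ).const_mul (b : ℂ)).const_sub 1) (hden ζ hζ)).const_mul (R : ℂ)).const_add
        (R : ℂ))
  have hηζ : ∀ ζ : ℂ, ‖ζ‖ < 1 → ‖η * ζ‖ < 1 := fun ζ hζ => by
    rw [norm_mul]; exact (mul_le_of_le_one_left (norm_nonneg _) hηn).trans_lt hζ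
  have hφd : ∀ ζ : ℂ, ‖ζ‖ < 1 → HasDerivAt (fun ζ : ℂ => q + ζ • a + g (η * ζ) • ν)
      ((1 : ℂ) • a + ((R * ((1 * (1 - b * (η * ζ)) - (η * ζ - b) * (-(b * 1))) /
        (1 - b * (η * ζ)) ^ 2)) * (η * 1)) • ν) ζ := fun ζ hζ =>
    (((hasDerivAt_id ζ).smul_const a).const_add q).add
      (((hgd _ (hηζ ζ hζ)).comp ζ ((hasDerivAt_id ζ).const_mul η)).smul_const ν)
  refine ⟨τ, fun ζ => q + ζ • a + g (η * ζ) • ν, ?_, ?_, ?_, ?_, ?_⟩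
  · intro ζ hζ
    exact (hφd ζ (by simpa using hζ)).differentiableAt.differentiableWithinAt
  · intro ζ hζ
    rw [mem_ball_zero_iff] at hζ
    -- The point over `ζ` lies in the ball tangent at `q + ζ a`: its offset from the centre is `(g
    -- (η ζ) - R) ν`.
    refine hB (ζ • a) (by rw [inner_smul_right, haν, mul_zero]) ?_ ?_
    · rw [norm_smul]
      exact (mul_le_of_le_one_left (norm_nonneg _) hζ.le).trans han
    · rw [mem_ball_iff_norm, ← Complex.coe_smul, add_sub_add_left_eq_sub, ← sub_smul, norm_smul, hν,
        mul_one]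
      have h1 : g (η * ζ) - R = R * ((η * ζ - b) / (1 - b * (η * ζ))) := add_sub_cancel_left _ _
      rw [h1, norm_mul, Complex.norm_real, Real.norm_eq_abs, abs_of_pos hR, norm_div]
      refine mul_lt_of_lt_one_right hR ?_
      rw [div_lt_one (norm_pos_iff.2 (hden _ (hηζ ζ hζ)))]
      exact norm_sub_lt_norm_one_sub_mul hbabs (hηζ ζ hζ)
  · have : g (η * 0) = (δ : ℂ) := by
      have : (R * b : ℂ) = R - δ := by exact_mod_cast hRb
      simp only [g, mul_zero, zero_sub, sub_zero, div_one]
      linear_combination -this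
    simp only [this, zero_smul, add_zero, Complex.coe_smul]
  · rw [(hφd 0 (by simp)).deriv]
    have hGc : (R * (1 - b ^ 2) : ℂ) = G := by rw [hG]; push_cast; ring
    have h1 : (R * ((1 * (1 - b * (η * 0)) - (η * 0 - b) * (-(b * 1))) /
        (1 - b * (η * 0)) ^ 2)) * (η * 1) = G * η := by
      rw [← hGc]; ring
    have hG0 : (G : ℂ) ≠ 0 := by exact_mod_cast hGpos.ne'
    rw [h1, one_smul]
    -- If `τ = 0`, the inverses in `a` and `η` are 0 by convention, and `X = 0`.
    by_cases h0 : τ = 0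
    · have hx0 : ‖x‖ / G = 0 := le_antisymm (h0 ▸ hτ1) (by positivity)
      have hT0 : ‖T‖ / r = 0 := le_antisymm (h0 ▸ hτ2) (by positivity)
      rw [div_eq_zero_iff, or_iff_left hGpos.ne', norm_eq_zero] at hx0
      rw [div_eq_zero_iff, or_iff_left hr.ne', norm_eq_zero, hT, hx0, zero_smul, sub_zero] at hT0
      rw [h0, hT0]; simp
    · have hτc : (τ : ℂ) ≠ 0 := by exact_mod_cast h0
      rw [smul_add, ha, smul_inv_smul₀ hτc, smul_smul]
      have : (τ * (G * η) : ℂ) = x := by rw [hη]; field_simp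
      rw [this, hT, sub_add_cancel]
  · rw [Complex.norm_real, Real.norm_eq_abs, abs_of_nonneg hτ0, hτ]
    -- After clearing denominators this amounts to `δ ≤ R`.
    have h1 : 1 / G ≤ 1 / (2 * δ) + 1 / (2 * R) := by
      rw [div_add_div _ _ (by positivity) (by positivity), div_le_div_iff₀ hGpos (by positivity),
        hG2]
      have : δ ^ 2 / R * R = δ ^ 2 := by field_simp
      have h3 : δ ^ 2 / R * δ ≤ δ ^ 2 := by
        rw [div_mul_eq_mul_div, div_le_iff₀ hR]; nlinarith [sq_nonneg δ]
      nlinarith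
    calc ‖x‖ / G + ‖T‖ / r = ‖x‖ * (1 / G) + 1 / r * ‖T‖ := by ring
      _ ≤ ‖x‖ * (1 / (2 * δ) + 1 / (2 * R)) + 1 / r * ‖X‖ := by gcongr
      _ = ‖x‖ / (2 * δ) + 1 / (2 * R) * ‖x‖ + 1 / r * ‖X‖ := by ring
      _ ≤ ‖x‖ / (2 * δ) + 1 / (2 * R) * ‖X‖ + 1 / r * ‖X‖ := by gcongr
      _ = _ := by ring

end metrics

/-- The local flow of a `C¹` vector field, for a uniform time and inside a given neighbourhood. -/
theorem ContDiffAt.exists_uniform_integralCurve {E : Type*} [NormedAddCommGroup E]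
    [NormedSpace ℝ E] [CompleteSpace E] {f : E → E} {x₀ : E} (hf : ContDiffAt ℝ 1 f x₀) {s : Set E}
    (hs : s ∈ 𝓝 x₀) :
    ∃ η > (0 : ℝ), ∃ r > (0 : ℝ), ∀ x ∈ ball x₀ r, ∃ α : ℝ → E, α 0 = x ∧
      ∀ t ∈ Ioo (-η) η, HasDerivAt α (f (α t)) t ∧ α t ∈ s := by
  obtain ⟨ε, hε, a, r, _, _, hr, hpl⟩ := IsPicardLindelof.of_contDiffAt_one hf
  obtain ⟨α, hα, hc⟩ := (hpl 0).exists_forall_mem_closedBall_eq_hasDerivWithinAt_continuousOn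
  simp only [zero_sub, zero_add] at hα hc
  have hmem : closedBall x₀ (r : ℝ) ×ˢ Icc (-ε) ε ∈ 𝓝 (x₀, (0 : ℝ)) :=
    prod_mem_nhds (closedBall_mem_nhds x₀ hr) (Icc_mem_nhds (by linarith) hε)
  have hα0 : α (x₀, 0) = x₀ := (hα x₀ (mem_closedBall_self r.2)).1
  -- Joint continuity of the flow at `(x₀, 0)` confines it to `s` for all nearby initial points and
  -- times at once.
  have hs' : ∀ᶠ y in 𝓝 (x₀, (0 : ℝ)), α y ∈ s :=
    (hc.continuousAt hmem).eventually_mem (by rwa [hα0])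
  obtain ⟨ε', hε', hball⟩ := Metric.eventually_nhds_iff_ball.1 hs'
  refine ⟨min ε ε', lt_min hε hε', min r ε', lt_min hr hε', fun x hx => ?_⟩
  have hxr : x ∈ closedBall x₀ (r : ℝ) :=
    (ball_subset_ball (min_le_left _ _)).trans ball_subset_closedBall hx
  refine ⟨fun t => α (x, t), (hα x hxr).1, fun t ht => ?_⟩
  have ht1 : t ∈ Ioo (-ε) ε :=
    ⟨by linarith [ht.1, min_le_left ε ε'], ht.2.trans_le (min_le_left _ _)⟩
  refine ⟨((hα x hxr).2 t (Ioo_subset_Icc_self ht1)).hasDerivAt (Icc_mem_nhds ht1.1 ht1.2),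
    hball _ ?_⟩
  rw [← ball_prod_same]
  refine ⟨ball_subset_ball (min_le_right _ _) hx, ?_⟩
  rw [mem_ball_zero_iff, Real.norm_eq_abs, abs_lt]
  exact ⟨by linarith [ht.1, min_le_right ε ε'], ht.2.trans_le (min_le_right _ _)⟩

/-! ### The unit normal and the Hessian of the defining function -/

section normal

variable {n : ℕ} {ρ : EuclideanSpace ℂ (Fin n) → ℝ} {q : EuclideanSpace ℂ (Fin n)}

theorem EuclideanSpace.inner_real_eq_re (x y : EuclideanSpace ℂ (Fin n)) :
    inner ℝ x y = (inner ℂ x y).re := by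
  simp [PiLp.inner_apply]

theorem norm_gradient (q : EuclideanSpace ℂ (Fin n)) : ‖gradient ρ q‖ = ‖fderiv ℝ ρ q‖ :=
  (InnerProductSpace.toDual ℝ _).symm.norm_map _

theorem norm_innerNormal (h : fderiv ℝ ρ q ≠ 0) : ‖innerNormal ρ q‖ = 1 := by
  have : ‖gradient ρ q‖ ≠ 0 := by rw [norm_gradient]; exact norm_ne_zero_iff.2 h
  rw [innerNormal, norm_neg, norm_smul, norm_inv, norm_norm, inv_mul_cancel₀ this]

theorem fderiv_apply_eq_innerNormal (q Y : EuclideanSpace ℂ (Fin n)) :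
    fderiv ℝ ρ q Y = -(‖fderiv ℝ ρ q‖ * inner ℝ (innerNormal ρ q) Y) := by
  rw [← norm_gradient, innerNormal, inner_neg_left, inner_smul_left, inner_gradient_left]
  by_cases h : fderiv ℝ ρ q = 0
  · simp [h]
  · have : ‖gradient ρ q‖ ≠ 0 := by rw [norm_gradient]; exact norm_ne_zero_iff.2 h
    simp only [map_inv₀, conj_trivial, mul_neg, neg_neg]
    field_simp

theorem fderiv_apply_eq_zero_iff (h : fderiv ℝ ρ q ≠ 0) (Y : EuclideanSpace ℂ (Fin n)) :
    fderiv ℝ ρ q Y = 0 ↔ inner ℝ (innerNormal ρ q) Y = 0 := by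
  rw [fderiv_apply_eq_innerNormal, neg_eq_zero, mul_eq_zero, or_iff_right (norm_ne_zero_iff.2 h)]

theorem mem_complexTangentSpace_iff (h : fderiv ℝ ρ q ≠ 0) (X : EuclideanSpace ℂ (Fin n)) :
    X ∈ complexTangentSpace ρ q ↔ inner ℂ (innerNormal ρ q) X = 0 := by
  change (fderiv ℝ ρ q X = 0 ∧ fderiv ℝ ρ q (Complex.I • X) = 0) ↔ _
  rw [fderiv_apply_eq_zero_iff h, fderiv_apply_eq_zero_iff h, EuclideanSpace.inner_real_eq_re,
    EuclideanSpace.inner_real_eq_re, inner_smul_right, Complex.ext_iff]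
  simp

theorem norm_normalComponent (h : fderiv ℝ ρ q ≠ 0) (X : EuclideanSpace ℂ (Fin n)) :
    ‖normalComponent ρ q X‖ = ‖inner ℂ (innerNormal ρ q) X‖ := by
  have hT : complexTangentSpace ρ q = (Submodule.span ℂ {innerNormal ρ q})ᗮ := by
    ext Y
    rw [mem_complexTangentSpace_iff h, Submodule.mem_orthogonal_singleton_iff_inner_right]
  have : normalComponent ρ q X = inner ℂ (innerNormal ρ q) X • innerNormal ρ q := by
    simp only [normalComponent, hT]
    rw [Submodule.starProjection_orthogonal, ← Submodule.starProjection_unit_singleton ℂ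
      (norm_innerNormal h) X]
    simp
  rw [this, norm_smul, norm_innerNormal h, mul_one]

theorem contDiffAt_gradient (hρ : ContDiffAt ℝ 2 ρ q) : ContDiffAt ℝ 1 (gradient ρ) q := by
  have h1 : ContDiffAt ℝ 1 (fderiv ℝ ρ) q := hρ.fderiv_right (by norm_num)
  let A : StrongDual ℝ (EuclideanSpace ℂ (Fin n)) →ₗ[ℝ] EuclideanSpace ℂ (Fin n) :=
    { toFun := (InnerProductSpace.toDual ℝ (EuclideanSpace ℂ (Fin n))).symm
      map_add' := fun x y => map_add _ x y
      map_smul' := fun c x => by simp }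
  exact (LinearMap.toContinuousLinearMap A).contDiff.contDiffAt.comp q h1

theorem gradient_ne_zero (h : fderiv ℝ ρ q ≠ 0) : gradient ρ q ≠ 0 := by
  rw [← norm_ne_zero_iff, norm_gradient]; exact norm_ne_zero_iff.2 h

theorem contDiffAt_innerNormal (hρ : ContDiffAt ℝ 2 ρ q) (h : fderiv ℝ ρ q ≠ 0) :
    ContDiffAt ℝ 1 (innerNormal ρ) q := by
  have h2 := contDiffAt_gradient hρ
  have h3 := gradient_ne_zero h
  exact (((h2.norm ℝ h3).inv (norm_ne_zero_iff.2 h3)).smul h2).neg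

/-- The line through `q` in direction `Y` stays in the tangent hyperplane, hence outside `Ω`, so `ρ
≥ 0` on it near `q`, with value 0 at `q`. -/
theorem hessian_nonneg_of_disjoint {Ω W : Set (EuclideanSpace ℂ (Fin n))}
    (hW : IsOpen W) (hin : Ω ∩ W = {z | z ∈ W ∧ ρ z < 0}) (hq : q ∈ W) (hq0 : ρ q = 0)
    (hρ : ContDiffAt ℝ 2 ρ q) (hd : Disjoint Ω (realTangentHyperplane ρ q))
    {Y : EuclideanSpace ℂ (Fin n)} (hY : fderiv ℝ ρ q Y = 0) :
    0 ≤ fderiv ℝ (fderiv ℝ ρ) q Y Y := by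
  by_contra! hneg
  have hline : ∀ t : ℝ, HasDerivAt (fun t : ℝ => q + t • Y) Y t := fun t => by
    simpa using ((hasDerivAt_id t).smul_const Y).const_add q
  have hcont : Tendsto (fun t : ℝ => q + t • Y) (𝓝 0) (𝓝 q) := by
    simpa using (hline 0).continuousAt.tendsto
  let g : ℝ → ℝ := fun t => ρ (q + t • Y)
  have hg1 : ∀ᶠ t in 𝓝 (0 : ℝ), HasDerivAt g (fderiv ℝ ρ (q + t • Y) Y) t := by
    have : ∀ᶠ x in 𝓝 q, DifferentiableAt ℝ ρ x := by
      filter_upwards [hρ.eventually (by simp)] with x hx using hx.differentiableAt (by norm_num)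
    filter_upwards [hcont.eventually this] with t ht
    exact ht.hasFDerivAt.comp_hasDerivAt t (hline t)
  have hg2 : deriv g =ᶠ[𝓝 0] fun t => fderiv ℝ ρ (q + t • Y) Y := by
    filter_upwards [hg1] with t ht using ht.deriv
  have hg3 : deriv (deriv g) 0 = fderiv ℝ (fderiv ℝ ρ) q Y Y := by
    rw [hg2.deriv_eq]
    have h1 : DifferentiableAt ℝ (fderiv ℝ ρ) q :=
      (hρ.fderiv_right (m := 1) (by norm_num)).differentiableAt (by norm_num)
    have h2 : HasFDerivAt (fderiv ℝ ρ) (fderiv ℝ (fderiv ℝ ρ) q) (q + (0 : ℝ) • Y) := by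
      simpa using h1.hasFDerivAt
    have h3 : HasDerivAt (fun t : ℝ => fderiv ℝ ρ (q + t • Y)) (fderiv ℝ (fderiv ℝ ρ) q Y) 0 :=
      h2.comp_hasDerivAt (0 : ℝ) (hline 0)
    have h4 : HasDerivAt (fun t : ℝ => fderiv ℝ ρ (q + t • Y) Y)
        (fderiv ℝ (fderiv ℝ ρ) q Y Y) 0 :=
      ((ContinuousLinearMap.apply ℝ ℝ Y).hasFDerivAt.comp_hasDerivAt (0 : ℝ) h3)
    exact h4.deriv
  have hg4 : deriv g 0 = 0 := by rw [hg2.eq_of_nhds]; simpa using hY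
  -- The second derivative test gives only a non-strict maximum. Together with `g ≥ 0` it forces `g`
  -- to vanish near 0, and then its second derivative is 0, a contradiction.
  have hmax := isLocalMax_of_deriv_deriv_neg (hg3 ▸ hneg) hg4 hg1.self_of_nhds.continuousAt
  have hmin : ∀ᶠ t in 𝓝 (0 : ℝ), 0 ≤ g t := by
    filter_upwards [hcont.eventually (hW.mem_nhds hq)] with t ht
    by_contra! hlt
    have : q + t • Y ∈ Ω ∩ W := by rw [hin]; exact ⟨ht, hlt⟩
    refine Set.disjoint_left.1 hd this.1 ?_
    simp [realTangentHyperplane, hY]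
  have hg0 : g =ᶠ[𝓝 0] fun _ => 0 := by
    filter_upwards [hmax, hmin] with t h1 h2
    have : g 0 = 0 := by simpa [g] using hq0
    exact le_antisymm (this ▸ h1) h2
  have : deriv (deriv g) 0 = 0 := by
    rw [hg0.deriv.deriv_eq]; simp
  rw [hg3] at this
  exact hneg.ne this

/-- Under Levi-flatness and semi-definiteness of the Hessian on the real tangent space, the
normal is infinitesimally constant in the complex tangential directions. -/
theorem fderiv_innerNormal_eq_zero (hρ : ContDiffAt ℝ 2 ρ q) (h : fderiv ℝ ρ q ≠ 0)
    (hnn : ∀ Y, fderiv ℝ ρ q Y = 0 → 0 ≤ fderiv ℝ (fderiv ℝ ρ) q Y Y)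
    (hL : ∀ X ∈ complexTangentSpace ρ q, leviForm ρ q X = 0)
    {X : EuclideanSpace ℂ (Fin n)} (hX : X ∈ complexTangentSpace ρ q) :
    fderiv ℝ (innerNormal ρ) q X = 0 := by
  set B := fderiv ℝ (fderiv ℝ ρ) q with hB
  have hsymm : ∀ u v, B u v = B v u := hρ.isSymmSndFDerivAt (by simp)
  have hXX : B X X = 0 := by
    have h1 := hnn X hX.1
    have h2 := hnn (Complex.I • X) hX.2
    have h3 := hL X hX
    rw [leviForm] at h3
    linarith
  have hXY : ∀ Y, fderiv ℝ ρ q Y = 0 → B X Y = 0 := by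
    intro Y hY
    -- Since `B X X = 0`, the form at `s X + Y` is affine in `s`; being bounded below, it has zero
    -- slope.
    have key : ∀ s : ℝ, 0 ≤ 2 * s * B X Y + B Y Y := by
      intro s
      have := hnn (s • X + Y) (by rw [map_add, map_smul, hX.1, hY]; simp)
      simp only [map_add, map_smul, add_apply, smul_apply,
        smul_eq_mul, hXX, hsymm Y X] at this
      linarith
    by_contra hne
    have := key (-(B Y Y + 1) / (2 * B X Y))
    have h2 : 2 * (-(B Y Y + 1) / (2 * B X Y)) * B X Y = -(B Y Y + 1) := by field_simp
    rw [h2] at this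
    linarith
  have hN : HasFDerivAt (innerNormal ρ) (fderiv ℝ (innerNormal ρ) q) q :=
    ((contDiffAt_innerNormal hρ h).differentiableAt (by norm_num)).hasFDerivAt
  set D := fderiv ℝ (innerNormal ρ) q with hD
  have hDf : HasFDerivAt (fderiv ℝ ρ) B q :=
    ((hρ.fderiv_right (m := 1) (by norm_num)).differentiableAt (by norm_num)).hasFDerivAt
  have hne : ∀ᶠ x in 𝓝 q, fderiv ℝ ρ x ≠ 0 := hDf.continuousAt.eventually_ne h
  have hDN : inner ℝ (innerNormal ρ q) (D X) = 0 := by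
    have h1 := hN.inner ℝ hN
    have h2 : (fun x => inner ℝ (innerNormal ρ x) (innerNormal ρ x)) =ᶠ[𝓝 q] fun _ => (1 : ℝ) := by
      filter_upwards [hne] with x hx
      rw [real_inner_self_eq_norm_sq, norm_innerNormal hx, one_pow]
    have h3 := congrArg (fun l => l X)
      ((h1.congr_of_eventuallyEq h2.symm).unique (hasFDerivAt_const (1 : ℝ) q))
    simp [fderivInnerCLM_apply, real_inner_comm] at h3
    linarith
  -- Differentiate `dρ_x(Y) = -‖∇ρ(x)‖ ⟨ν_x, Y⟩` along `X` with `Y` fixed. The derivative of `‖∇ρ‖`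
  -- drops out because `⟨ν_q, Y⟩ = 0`.
  have hDY : ∀ Y, inner ℝ (innerNormal ρ q) Y = 0 → inner ℝ (D X) Y = 0 := by
    intro Y hY
    have h1 : HasFDerivAt (fun x => fderiv ℝ ρ x Y) (B.flip Y) q := by
      simpa using hDf.clm_apply (hasFDerivAt_const Y q)
    have hg : DifferentiableAt ℝ (fun x => ‖gradient ρ x‖) q :=
      ((contDiffAt_gradient hρ).norm ℝ (gradient_ne_zero h)).differentiableAt (by norm_num)
    have h2 := (hg.hasFDerivAt.mul (hN.inner ℝ (hasFDerivAt_const Y q))).neg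
    have h3 : (fun x => fderiv ℝ ρ x Y) =
        fun x => -(‖gradient ρ x‖ * inner ℝ (innerNormal ρ x) Y) := by
      funext x
      rw [fderiv_apply_eq_innerNormal, norm_gradient]
    rw [h3] at h1
    have h4 := congrArg (fun l => l X) (h1.unique h2)
    have h5 := hXY Y ((fderiv_apply_eq_zero_iff h Y).2 hY)
    simp [fderivInnerCLM_apply, hY, h5, gradient_ne_zero h] at h4
    exact h4
  -- `D X` is orthogonal to the normal, so it is an admissible `Y` and is orthogonal to itself.
  have := hDY (D X) hDN
  exact inner_self_eq_zero.1 this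

end normal

/-! ### Interior balls, supporting half-spaces and flat leaves -/

section geometry

variable {n : ℕ} {Ω W : Set (EuclideanSpace ℂ (Fin n))} {ρ : EuclideanSpace ℂ (Fin n) → ℝ}
  {p q : EuclideanSpace ℂ (Fin n)}

theorem IsC2DefiningFunction.eq_zero_of_mem_frontier (hρ : IsC2DefiningFunction Ω W ρ)
    (hΩ : IsOpen Ω) (hq : q ∈ frontier Ω) (hqW : q ∈ W) : ρ q = 0 := by
  rw [hΩ.frontier_eq] at hq
  refine le_antisymm ?_ ?_
  · by_contra! hpos
    have hc : ContinuousAt ρ q := hρ.contDiffOn.continuousOn.continuousAt (hρ.isOpen.mem_nhds hqW)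
    obtain ⟨x, ⟨hxW, hx⟩, hxΩ⟩ := mem_closure_iff_nhds.1 hq.1 _
      (inter_mem (hρ.isOpen.mem_nhds hqW) (hc.eventually (lt_mem_nhds hpos)))
    have : x ∈ Ω ∩ W := ⟨hxΩ, hxW⟩
    rw [hρ.inter_eq] at this
    exact lt_asymm hx this.2
  · by_contra! hneg
    have : q ∈ Ω ∩ W := by rw [hρ.inter_eq]; exact ⟨hqW, hneg⟩
    exact hq.2 this.1

theorem IsC2DefiningFunction.contDiffAt (hρ : IsC2DefiningFunction Ω W ρ) (hq : q ∈ W) :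
    ContDiffAt ℝ 2 ρ q :=
  hρ.contDiffOn.contDiffAt (hρ.isOpen.mem_nhds hq)

theorem norm_sq_lt_of_mem_ball {d ν : EuclideanSpace ℂ (Fin n)} (hν : ‖ν‖ = 1) {R : ℝ}
    (hd : ‖d - R • ν‖ < R) : ‖d‖ ^ 2 < 2 * R * inner ℝ ν d := by
  have hR : 0 < R := (norm_nonneg _).trans_lt hd
  have h1 : ‖d - R • ν‖ ^ 2 < R ^ 2 := by gcongr
  rw [norm_sub_sq_real, norm_smul, hν, Real.norm_eq_abs, abs_of_pos hR, inner_smul_right,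
    real_inner_comm] at h1
  linarith

/-- Uniform interior ball condition. -/
theorem ball_subset_of_fderiv_lipschitz (hin : Ω ∩ W = {z | z ∈ W ∧ ρ z < 0})
    {s L m R : ℝ} (hsW : ball q s ⊆ W) (hdiff : ∀ x ∈ ball q s, DifferentiableAt ℝ ρ x)
    (hL0 : 0 ≤ L) (hL : ∀ x ∈ ball q s, ‖fderiv ℝ ρ x - fderiv ℝ ρ q‖ ≤ L * ‖x - q‖)
    (hm : 0 < m) (hmq : m ≤ ‖fderiv ℝ ρ q‖) (hR : 0 < R) (hRs : 2 * R ≤ s) (hRL : 2 * R * L ≤ m)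
    (hq : ρ q = 0) : ball (q + R • innerNormal ρ q) R ⊆ Ω := by
  intro w hw
  have hν := norm_innerNormal (ρ := ρ) (q := q) (norm_pos_iff.1 (hm.trans_le hmq))
  set ν := innerNormal ρ q
  set d := w - q with hd
  have hdR : ‖d - R • ν‖ < R := by rwa [hd, sub_sub, ← mem_ball_iff_norm]
  have hd2 : ‖d‖ < 2 * R := by
    calc ‖d‖ = ‖(d - R • ν) + R • ν‖ := by rw [sub_add_cancel]
      _ ≤ ‖d - R • ν‖ + ‖R • ν‖ := norm_add_le _ _
      _ = ‖d - R • ν‖ + R := by rw [norm_smul, hν, mul_one, Real.norm_eq_abs, abs_of_pos hR]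
      _ < 2 * R := by linarith
  have hsq := norm_sq_lt_of_mem_ball hν hdR
  have hsub : closedBall q ‖d‖ ⊆ ball q s := closedBall_subset_ball (hd2.trans_le hRs)
  have hwm : w ∈ closedBall q ‖d‖ := by rw [mem_closedBall_iff_norm]
  have htaylor := (convex_closedBall q ‖d‖).norm_image_sub_le_of_norm_fderiv_le' (𝕜 := ℝ)
    (fun x hx => hdiff x (hsub hx)) (φ := fderiv ℝ ρ q) (C := L * ‖d‖)
    (fun x hx => (hL x (hsub hx)).trans
      (mul_le_mul_of_nonneg_left (mem_closedBall_iff_norm.1 hx) hL0))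
    (mem_closedBall_self (norm_nonneg d)) hwm
  rw [hq, sub_zero, ← hd, fderiv_apply_eq_innerNormal, Real.norm_eq_abs] at htaylor
  have h1 := (abs_le.1 htaylor).2
  change ρ w - -(‖fderiv ℝ ρ q‖ * inner ℝ ν d) ≤ _ at h1
  have hpos : 0 < inner ℝ ν d := by
    have : 0 < 2 * R * inner ℝ ν d := (sq_nonneg _).trans_lt hsq
    exact pos_of_mul_pos_right this (by positivity)
  have h2 : m * inner ℝ ν d ≤ ‖fderiv ℝ ρ q‖ * inner ℝ ν d := by gcongr
  have h3 : 2 * R * L * inner ℝ ν d ≤ m * inner ℝ ν d := by gcongr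
  have hlt : ρ w < 0 := by
    -- Strictness comes from `‖d‖² < 2R ⟨ν, d⟩` multiplied by `L`, which needs `L > 0`; for `L = 0`
    -- it comes from `m ⟨ν, d⟩ > 0`.
    rcases hL0.eq_or_lt with h0 | h0
    · rw [← h0] at h1
      nlinarith [mul_pos hm hpos]
    · nlinarith [mul_lt_mul_of_pos_left hsq h0]
  have : w ∈ Ω ∩ W := by rw [hin]; exact ⟨hsW (hsub hwm), hlt⟩
  exact this.1

/-- By connectedness `Ω` lies on one side of the hyperplane; the point `q + R ν` tells which. -/
theorem inner_innerNormal_pos_of_disjoint (hΩ : IsPreconnected Ω) (h : fderiv ℝ ρ q ≠ 0)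
    (hd : Disjoint Ω (realTangentHyperplane ρ q)) {R : ℝ} (hR : 0 < R)
    (hmem : q + R • innerNormal ρ q ∈ Ω) {w : EuclideanSpace ℂ (Fin n)} (hw : w ∈ Ω) :
    0 < inner ℝ (innerNormal ρ q) (w - q) := by
  by_contra! hle
  have hcont : ContinuousOn (fun w => inner ℝ (innerNormal ρ q) (w - q)) Ω :=
    (continuous_const.inner (continuous_id.sub continuous_const)).continuousOn
  obtain ⟨x, hx, hx0⟩ := hΩ.intermediate_value hw hmem hcont (show (0 : ℝ) ∈ _ from ⟨hle, by
    simp only [add_sub_cancel_left, inner_smul_right, real_inner_self_eq_norm_sq,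
      norm_innerNormal h]
    linarith⟩)
  exact Set.disjoint_left.1 hd hx ((fderiv_apply_eq_zero_iff h _).2 hx0)

/-- The level set `ρ = 0` is foliated near `p` by pieces of complex hyperplanes along which the
normal is constant, provided the normal is infinitesimally constant in complex tangential
directions. -/
theorem exists_flat_leaves {s : Set (EuclideanSpace ℂ (Fin n))} (hs : s ∈ 𝓝 p)
    (hp : ContDiffAt ℝ 1 (innerNormal ρ) p)
    (hρd : ∀ x ∈ s, DifferentiableAt ℝ ρ x) (hne : ∀ x ∈ s, fderiv ℝ ρ x ≠ 0)
    (hνd : ∀ x ∈ s, DifferentiableAt ℝ (innerNormal ρ) x)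
    (hflat : ∀ x ∈ s, ρ x = 0 → ∀ X ∈ complexTangentSpace ρ x, fderiv ℝ (innerNormal ρ) x X = 0) :
    ∃ ε > (0 : ℝ), ∃ r > (0 : ℝ), ∀ q ∈ ball p ε, ρ q = 0 → ∀ a : EuclideanSpace ℂ (Fin n),
      inner ℂ (innerNormal ρ q) a = 0 → ‖a‖ ≤ r →
        q + a ∈ s ∧ ρ (q + a) = 0 ∧ innerNormal ρ (q + a) = innerNormal ρ q := by
  -- The second component is a frozen direction `v`; the first moves with the complex tangential
  -- projection of `v`. Making `v` part of the state gives one flow time for all small directions.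
  let V : EuclideanSpace ℂ (Fin n) × EuclideanSpace ℂ (Fin n) →
      EuclideanSpace ℂ (Fin n) × EuclideanSpace ℂ (Fin n) := fun y =>
    (y.2 - (inner ℂ (innerNormal ρ y.1) y.2 : ℂ) • innerNormal ρ y.1, 0)
  have hV : ContDiffAt ℝ 1 V (p, 0) := by
    have h1 : ContDiffAt ℝ 1 (fun y : EuclideanSpace ℂ (Fin n) × EuclideanSpace ℂ (Fin n) =>
        innerNormal ρ y.1) (p, 0) :=
      ContDiffAt.comp (g := innerNormal ρ) (p, (0 : EuclideanSpace ℂ (Fin n))) hp contDiffAt_fst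
    exact (contDiffAt_snd.sub ((h1.inner ℂ contDiffAt_snd).smul h1)).prodMk contDiffAt_const
  obtain ⟨η, hη, r, hr, hflow⟩ := hV.exists_uniform_integralCurve
    (s := s ×ˢ univ) (prod_mem_nhds hs univ_mem)
  set T := η / 2 with hT
  have hT0 : 0 < T := by positivity
  refine ⟨r, hr, T * (r / 2), by positivity, fun q hq hq0 a ha har => ?_⟩
  obtain ⟨α, hα0, hα⟩ := hflow (q, T⁻¹ • a) (by
    rw [← ball_prod_same]
    refine ⟨hq, ?_⟩
    rw [mem_ball_zero_iff, norm_smul, norm_inv, Real.norm_eq_abs, abs_of_pos hT0]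
    calc T⁻¹ * ‖a‖ ≤ T⁻¹ * (T * (r / 2)) := by gcongr
      _ = r / 2 := by field_simp
      _ < r := by linarith)
  set v := T⁻¹ • a with hv
  have hIcc : Icc 0 T ⊆ Ioo (-η) η := fun t ht => ⟨by linarith [ht.1], by linarith [ht.2]⟩
  have hu' : ∀ t ∈ Icc 0 T, HasDerivAt (fun t => (α t).2) 0 t := fun t ht =>
    (hα t (hIcc ht)).1.snd
  have hu : ∀ t ∈ Icc 0 T, (α t).2 = v := by
    intro t ht
    have := constant_of_has_deriv_right_zero (f := fun t => (α t).2)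
      (fun t ht => (hu' t ht).continuousAt.continuousWithinAt)
      (fun t ht => (hu' t (Ico_subset_Icc_self ht)).hasDerivWithinAt) t ht
    rw [this, hα0]
  have hw' : ∀ t ∈ Icc 0 T, HasDerivAt (fun t => (α t).1)
      (v - (inner ℂ (innerNormal ρ (α t).1) v : ℂ) • innerNormal ρ (α t).1) t := by
    intro t ht
    refine (hasFDerivAt_fst.comp_hasDerivAt t (hα t (hIcc ht)).1).congr_deriv ?_
    simp [V, hu t ht]
  have hws : ∀ t ∈ Icc 0 T, (α t).1 ∈ s := fun t ht => (hα t (hIcc ht)).2.1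
  have htan : ∀ t ∈ Icc 0 T, (v - (inner ℂ (innerNormal ρ (α t).1) v : ℂ) •
      innerNormal ρ (α t).1) ∈ complexTangentSpace ρ (α t).1 := by
    intro t ht
    have h := hne _ (hws t ht)
    rw [mem_complexTangentSpace_iff h, inner_sub_right, inner_smul_right,
      inner_self_eq_norm_sq_to_K, norm_innerNormal h]
    simp
  -- The velocity is tangent, so the curve stays in `ρ = 0`. There `hflat` applies and keeps the
  -- normal constant. Hence `v`, orthogonal to the initial normal, is its own projection throughout,
  -- and the curve is a straight segment.
  have hρ' : ∀ t ∈ Icc 0 T, HasDerivAt (fun t => ρ (α t).1) 0 t := fun t ht =>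
    ((hρd _ (hws t ht)).hasFDerivAt.comp_hasDerivAt t (hw' t ht)).congr_deriv (htan t ht).1
  have hρ0 : ∀ t ∈ Icc 0 T, ρ (α t).1 = 0 := by
    intro t ht
    have := constant_of_has_deriv_right_zero (f := fun t => ρ (α t).1)
      (fun t ht => (hρ' t ht).continuousAt.continuousWithinAt)
      (fun t ht => (hρ' t (Ico_subset_Icc_self ht)).hasDerivWithinAt) t ht
    rw [this, hα0, hq0]
  have hν' : ∀ t ∈ Icc 0 T, HasDerivAt (fun t => innerNormal ρ (α t).1) 0 t := fun t ht =>
    (HasFDerivAt.comp_hasDerivAt (l := innerNormal ρ) t (hνd _ (hws t ht)).hasFDerivAt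
      (hw' t ht)).congr_deriv
      (hflat _ (hws t ht) (hρ0 t ht) _ (htan t ht))
  have hν : ∀ t ∈ Icc 0 T, innerNormal ρ (α t).1 = innerNormal ρ q := by
    intro t ht
    have := constant_of_has_deriv_right_zero (f := fun t => innerNormal ρ (α t).1)
      (fun t ht => (hν' t ht).continuousAt.continuousWithinAt)
      (fun t ht => (hν' t (Ico_subset_Icc_self ht)).hasDerivWithinAt) t ht
    rw [this, hα0]
  have hva : inner ℂ (innerNormal ρ q) v = 0 := by
    rw [hv, ← Complex.coe_smul, inner_smul_right, ha, mul_zero]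
  have hline' : ∀ t ∈ Icc 0 T, HasDerivAt (fun t => (α t).1 - t • v) 0 t := by
    intro t ht
    have h1 := hw' t ht
    rw [hν t ht, hva, zero_smul, sub_zero] at h1
    exact (h1.sub ((hasDerivAt_id t).smul_const v)).congr_deriv (by simp)
  have hTm : T ∈ Icc 0 T := ⟨hT0.le, le_rfl⟩
  have hend : (α T).1 = q + a := by
    have := constant_of_has_deriv_right_zero (f := fun t => (α t).1 - t • v)
      (fun t ht => (hline' t ht).continuousAt.continuousWithinAt)
      (fun t ht => (hline' t (Ico_subset_Icc_self ht)).hasDerivWithinAt) T hTm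
    rw [hα0, zero_smul, sub_zero, hv, smul_inv_smul₀ hT0.ne', sub_eq_iff_eq_add] at this
    exact this
  exact hend ▸ ⟨hws T hTm, hρ0 T hTm, hν T hTm⟩

/-- The local structure of a Levi-flat boundary whose tangent hyperplanes do not meet the
domain. -/
theorem exists_local_geometry (hΩo : IsOpen Ω) (hΩc : IsPreconnected Ω) (hpW : p ∈ W)
    (hp : p ∈ frontier Ω) (hρ : IsC2DefiningFunction Ω W ρ) (hLevi : LeviFlatNear Ω ρ p)
    (hav : AvoidsTangentHyperplanesNear Ω ρ p) :
    ∃ ε > (0 : ℝ), ∃ R > (0 : ℝ), ∃ r > (0 : ℝ), ∃ K : NNReal, ball p ε ⊆ W ∧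
      LipschitzOnWith K (innerNormal ρ) (ball p ε) ∧
      ∀ q ∈ frontier Ω, q ∈ ball p ε → fderiv ℝ ρ q ≠ 0 ∧
        (∀ w ∈ Ω, 0 < inner ℝ (innerNormal ρ q) (w - q)) ∧
        ∀ a : EuclideanSpace ℂ (Fin n), inner ℂ (innerNormal ρ q) a = 0 → ‖a‖ ≤ r →
          ball (q + a + R • innerNormal ρ q) R ⊆ Ω := by
  have hp0 := hρ.fderiv_ne_zero p hpW (hρ.eq_zero_of_mem_frontier hΩo hp hpW)
  have hνp := contDiffAt_innerNormal (hρ.contDiffAt hpW) hp0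
  have hfd : ContDiffAt ℝ 1 (fderiv ℝ ρ) p := (hρ.contDiffAt hpW).fderiv_right (by norm_num)
  obtain ⟨L, sL, hsL, hL⟩ := hfd.exists_lipschitzOnWith
  obtain ⟨K, sK, hsK, hK⟩ := hνp.exists_lipschitzOnWith
  set m := ‖fderiv ℝ ρ p‖ / 2 with hm
  have hm0 : 0 < m := half_pos (norm_pos_iff.2 hp0)
  have hbig : ∀ᶠ x in 𝓝 p, m ≤ ‖fderiv ℝ ρ x‖ := by
    refine (hfd.continuousAt.norm.eventually (lt_mem_nhds ?_)).mono fun x hx => hx.le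
    rw [hm]; linarith
  have hgood : ∀ᶠ x in 𝓝 p, x ∈ W ∧ x ∈ sL ∧ x ∈ sK ∧ m ≤ ‖fderiv ℝ ρ x‖ ∧
      (x ∈ frontier Ω → (∀ X ∈ complexTangentSpace ρ x, leviForm ρ x X = 0) ∧
        Disjoint Ω (realTangentHyperplane ρ x)) := by
    filter_upwards [hρ.isOpen.mem_nhds hpW, hsL, hsK, hbig, eventually_nhdsWithin_iff.1 hLevi,
      eventually_nhdsWithin_iff.1 hav] with x h1 h2 h3 h4 h5 h6
    exact ⟨h1, h2, h3, h4, fun h => ⟨h5 h, h6 h⟩⟩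
  obtain ⟨ε₀, hε₀, hball⟩ := Metric.eventually_nhds_iff_ball.1 hgood
  have hne : ∀ x ∈ ball p ε₀, fderiv ℝ ρ x ≠ 0 := fun x hx =>
    norm_pos_iff.1 (hm0.trans_le (hball x hx).2.2.2.1)
  -- The first bound keeps balls of radius `2R` around points of the half-size ball inside `ball p
  -- ε₀`; the second gives `2RL ≤ m`, with `L + 1` guarding against `L = 0`.
  set R := min (ε₀ / 4) (m / (2 * (L + 1))) with hRdef
  have hR : 0 < R := by positivity
  have hRε : 2 * R ≤ ε₀ / 2 := by linarith [min_le_left (ε₀ / 4) (m / (2 * (L + 1)))]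
  have hRL : 2 * R * L ≤ m := by
    have h1 : R ≤ m / (2 * (L + 1)) := min_le_right _ _
    rw [le_div_iff₀ (by positivity)] at h1
    nlinarith [L.2]
  have hhalf : ball p (ε₀ / 2) ⊆ ball p ε₀ := ball_subset_ball (by linarith)
  have hint : ∀ x ∈ ball p (ε₀ / 2), ρ x = 0 → ball (x + R • innerNormal ρ x) R ⊆ Ω := by
    intro x hx hx0
    have hsub : ball x (ε₀ / 2) ⊆ ball p ε₀ := ball_subset_ball' (by
      rw [mem_ball] at hx; linarith)
    refine ball_subset_of_fderiv_lipschitz hρ.inter_eq (fun y hy => (hball y (hsub hy)).1)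
      (fun y hy => (hρ.contDiffAt (hball y (hsub hy)).1).differentiableAt (by norm_num)) L.2
      (fun y hy => hL.norm_sub_le (hball y (hsub hy)).2.1 (hball x (hhalf hx)).2.1) hm0
      (hball x (hhalf hx)).2.2.2.1 hR hRε hRL hx0
  -- Levi-flatness and the tangent condition are known only at boundary points, whereas the leaves
  -- are built in `ρ = 0`. The interior ball shows that such a zero is a limit of points of `Ω`.
  have hfr : ∀ x ∈ ball p (ε₀ / 2), ρ x = 0 → x ∈ frontier Ω := by
    intro x hx hx0
    rw [hΩo.frontier_eq]
    constructor
    · refine closure_mono (hint x hx hx0) ?_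
      rw [closure_ball _ hR.ne', mem_closedBall_iff_norm, sub_add_cancel_left, norm_neg, norm_smul,
        norm_innerNormal (hne x (hhalf hx)), mul_one, Real.norm_eq_abs, abs_of_pos hR]
    · intro hxΩ
      have : x ∈ Ω ∩ W := ⟨hxΩ, (hball x (hhalf hx)).1⟩
      rw [hρ.inter_eq] at this
      exact this.2.ne hx0
  obtain ⟨ε₁, hε₁, r, hr, hleaf⟩ := exists_flat_leaves (ρ := ρ)
    (ball_mem_nhds p (half_pos hε₀)) hνp
    (fun x hx => (hρ.contDiffAt (hball x (hhalf hx)).1).differentiableAt (by norm_num))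
    (fun x hx => hne x (hhalf hx))
    (fun x hx => (contDiffAt_innerNormal (hρ.contDiffAt (hball x (hhalf hx)).1)
      (hne x (hhalf hx))).differentiableAt (by norm_num))
    (fun x hx hx0 X hX => by
      obtain ⟨hxW, -, -, -, hx2⟩ := hball x (hhalf hx)
      obtain ⟨hx3, hx4⟩ := hx2 (hfr x hx hx0)
      exact fderiv_innerNormal_eq_zero (hρ.contDiffAt hxW) (hne x (hhalf hx))
        (fun Y hY => hessian_nonneg_of_disjoint hρ.isOpen hρ.inter_eq hxW hx0
          (hρ.contDiffAt hxW) hx4 hY) hx3 hX)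
  refine ⟨min (ε₀ / 2) ε₁, lt_min (half_pos hε₀) hε₁, R, hR, r, hr, K, ?_, ?_, ?_⟩
  · exact fun x hx => (hball x (hhalf (ball_subset_ball (min_le_left _ _) hx))).1
  · exact hK.mono fun x hx => (hball x (hhalf (ball_subset_ball (min_le_left _ _) hx))).2.2.1
  · intro q hq hqε
    have hq1 : q ∈ ball p (ε₀ / 2) := ball_subset_ball (min_le_left _ _) hqε
    have hq0 := hρ.eq_zero_of_mem_frontier hΩo hq (hball q (hhalf hq1)).1
    refine ⟨hne q (hhalf hq1), fun w hw => ?_, fun a ha har => ?_⟩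
    · exact inner_innerNormal_pos_of_disjoint hΩc (hne q (hhalf hq1))
        ((hball q (hhalf hq1)).2.2.2.2 hq).2 hR (hint q hq1 hq0 (mem_ball_self hR)) hw
    · obtain ⟨h1, h2, h3⟩ := hleaf q (ball_subset_ball (min_le_right _ _) hqε) hq0 a ha har
      rw [← h3]
      exact hint _ h1 h2

/-- Segments from `q` into `Ω` have `ρ < 0`, so `dρ_q (w - q) ≤ 0` on `Ω`. Equality is impossible
because `Ω` is open: shifting `w` slightly along the outer normal would make the value positive. -/
theorem avoidsTangentHyperplanesNear_of_convex (hΩ : IsOpen Ω) (hpW : p ∈ W)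
    (hρ : IsC2DefiningFunction Ω W ρ) (hconv : Convex ℝ Ω) :
    AvoidsTangentHyperplanesNear Ω ρ p := by
  refine eventually_nhdsWithin_iff.2 ?_
  filter_upwards [hρ.isOpen.mem_nhds hpW] with q hqW hq
  have hq0 := hρ.eq_zero_of_mem_frontier hΩ hq hqW
  have hne := hρ.fderiv_ne_zero q hqW hq0
  have hνn := norm_innerNormal hne
  have hle : ∀ w ∈ Ω, fderiv ℝ ρ q (w - q) ≤ 0 := by
    intro w hw
    have hd : HasDerivAt (fun t : ℝ => ρ (q + t • (w - q))) (fderiv ℝ ρ q (w - q)) 0 := by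
      have h1 : HasDerivAt (fun t : ℝ => q + t • (w - q)) (w - q) 0 := by
        simpa using ((hasDerivAt_id (0 : ℝ)).smul_const (w - q)).const_add q
      have h2 : HasFDerivAt ρ (fderiv ℝ ρ q) (q + (0 : ℝ) • (w - q)) := by
        simpa using ((hρ.contDiffAt hqW).differentiableAt (by norm_num)).hasFDerivAt
      exact h2.comp_hasDerivAt (0 : ℝ) h1
    have hcont : Tendsto (fun t : ℝ => q + t • (w - q)) (𝓝[>] 0) (𝓝 q) := by
      have : Continuous fun t : ℝ => q + t • (w - q) := by fun_prop
      simpa using (this.tendsto 0).mono_left nhdsWithin_le_nhds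
    refine le_of_tendsto ((hasDerivWithinAt_iff_tendsto_slope' self_notMem_Ioi).1
      (hd.hasDerivWithinAt (s := Ioi 0))) ?_
    filter_upwards [hcont.eventually (hρ.isOpen.mem_nhds hqW), Ioo_mem_nhdsGT one_pos]
      with t htW ht
    have hmem : q + t • (w - q) ∈ Ω := by
      have := hconv.openSegment_closure_interior_subset_interior
        (frontier_subset_closure hq) (hΩ.interior_eq.symm ▸ hw)
      refine interior_subset (this ⟨1 - t, t, by linarith [ht.2], ht.1, by ring, ?_⟩)
      rw [sub_smul, smul_sub, one_smul]
      abel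
    have : q + t • (w - q) ∈ Ω ∩ W := ⟨hmem, htW⟩
    rw [hρ.inter_eq] at this
    rw [slope_def_field, zero_smul, add_zero, hq0, sub_zero, sub_zero]
    exact div_nonpos_of_nonpos_of_nonneg this.2.le ht.1.le
  rw [Set.disjoint_left]
  intro w hw hwT
  have hcont : Tendsto (fun t : ℝ => w - t • innerNormal ρ q) (𝓝[>] 0) (𝓝 w) := by
    have : Continuous fun t : ℝ => w - t • innerNormal ρ q := by fun_prop
    simpa using (this.tendsto 0).mono_left nhdsWithin_le_nhds
  obtain ⟨t, htΩ, ht0⟩ := ((hcont.eventually (hΩ.mem_nhds hw)).and self_mem_nhdsWithin).exists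
  have h1 := hle _ htΩ
  have h2 : w - t • innerNormal ρ q - q = (w - q) - t • innerNormal ρ q := by abel
  rw [h2, map_sub, show fderiv ℝ ρ q (w - q) = 0 from hwT, map_smul,
    fderiv_apply_eq_innerNormal q (innerNormal ρ q), real_inner_self_eq_norm_sq, hνn] at h1
  have h3 : 0 < t * ‖fderiv ℝ ρ q‖ := mul_pos ht0 (norm_pos_iff.2 hne)
  simp at h1
  linarith

end geometry

/-! ### Foot points and the final estimate -/

/-- The ball is connected, meets `Ω` at its centre and contains no boundary point. -/
theorem ball_boundaryDist_subset {n : ℕ} {Ω : Set (EuclideanSpace ℂ (Fin n))} (hΩ : IsOpen Ω)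
    {z : EuclideanSpace ℂ (Fin n)} (hz : z ∈ Ω) (hδ : 0 < boundaryDist Ω z) :
    ball z (boundaryDist Ω z) ⊆ Ω := by
  refine (convex_ball z _).isPreconnected.subset_of_closure_inter_subset hΩ
    ⟨z, mem_ball_self hδ, hz⟩ ?_
  rintro x ⟨hxc, hxb⟩
  by_contra hx
  have hxf : x ∈ frontier Ω := by rw [hΩ.frontier_eq]; exact ⟨hxc, hx⟩
  have := infDist_le_dist_of_mem (x := z) hxf
  rw [mem_ball, dist_comm] at hxb
  exact (this.trans_lt hxb).ne rfl

/-- A nearest boundary point `q`, at which the domain lies in the half-space with inner normal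
`ν`, is joined to `z` by the normal. -/
theorem eq_add_boundaryDist_smul {n : ℕ} {Ω : Set (EuclideanSpace ℂ (Fin n))} (hΩ : IsOpen Ω)
    {z q ν : EuclideanSpace ℂ (Fin n)} (hz : z ∈ Ω) (hδ : 0 < boundaryDist Ω z)
    (hq : boundaryDist Ω z = dist z q) (hν : ‖ν‖ = 1)
    (hH : ∀ w ∈ Ω, 0 < inner ℝ ν (w - q)) : z = q + boundaryDist Ω z • ν := by
  set δ := boundaryDist Ω z
  -- The ball of radius `δ` about `z` lies in the half-space, so `z` has height at least `δ = ‖z -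
  -- q‖` over the hyperplane. This is the equality case of Cauchy–Schwarz.
  have hle : δ ≤ inner ℝ ν (z - q) := by
    refine le_of_forall_lt_imp_le_of_dense fun s hs => ?_
    rcases le_or_gt s 0 with h0 | h0
    · exact h0.trans (hH z hz).le
    have hmem : z - s • ν ∈ Ω := by
      refine ball_boundaryDist_subset hΩ hz hδ ?_
      rwa [mem_ball_iff_norm, sub_sub_cancel_left, norm_neg, norm_smul, hν, mul_one,
        Real.norm_eq_abs, abs_of_pos h0]
    have h1 := hH _ hmem
    have h2 : z - s • ν - q = (z - q) - s • ν := by abel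
    rw [h2, inner_sub_right, inner_smul_right, real_inner_self_eq_norm_sq, hν] at h1
    linarith
  have hnorm : ‖(z - q) - δ • ν‖ ^ 2 ≤ 0 := by
    rw [norm_sub_sq_real, norm_smul, hν, Real.norm_eq_abs, abs_of_pos hδ, inner_smul_right,
      real_inner_comm, ← dist_eq_norm, ← hq]
    nlinarith
  have : (z - q) - δ • ν = 0 := by
    rw [← norm_eq_zero]
    exact pow_eq_zero_iff two_ne_zero |>.1 (le_antisymm hnorm (sq_nonneg _))
  rw [sub_eq_zero] at this
  rw [← this, add_sub_cancel]

theorem proposition6p1 {n : ℕ} (Ω : Set (EuclideanSpace ℂ (Fin n)))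
    (hΩ_open : IsOpen Ω) (hΩ_conn : IsConnected Ω)
    (p : EuclideanSpace ℂ (Fin n)) (hp : p ∈ frontier Ω)
    (W : Set (EuclideanSpace ℂ (Fin n))) (hpW : p ∈ W)
    (ρ : EuclideanSpace ℂ (Fin n) → ℝ) (hρ : IsC2DefiningFunction Ω W ρ)
    (hLevi : LeviFlatNear Ω ρ p) :
    (Convex ℝ Ω → AvoidsTangentHyperplanesNear Ω ρ p) ∧
    (AvoidsTangentHyperplanesNear Ω ρ p →
      ∃ U ∈ 𝓝 p, ∃ c : ℝ, 0 < c ∧ ∀ z ∈ Ω ∩ U,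
        (∃! q, IsFootPoint Ω W ρ z q) ∧
        ∀ q, IsFootPoint Ω W ρ z q → ∀ X : EuclideanSpace ℂ (Fin n),
          (0 ≤ caratheodoryMetric Ω z X - ‖normalComponent ρ q X‖ / (2 * boundaryDist Ω z) ∧
            caratheodoryMetric Ω z X - ‖normalComponent ρ q X‖ / (2 * boundaryDist Ω z)
              ≤ c * ‖X‖) ∧
          (0 ≤ kobayashiMetric Ω z X - ‖normalComponent ρ q X‖ / (2 * boundaryDist Ω z) ∧
            kobayashiMetric Ω z X - ‖normalComponent ρ q X‖ / (2 * boundaryDist Ω z)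
              ≤ c * ‖X‖)) := by
  refine ⟨avoidsTangentHyperplanesNear_of_convex hΩ_open hpW hρ, fun hav => ?_⟩
  obtain ⟨ε, hε, R, hR, r, hr, K, hεW, hK, hgeo⟩ :=
    exists_local_geometry hΩ_open hΩ_conn.isPreconnected hpW hp hρ hLevi hav
  -- `ε / 2` puts foot points in `ball p ε`, `R` ensures `δ ≤ R` for the disc competitor, and `1 /
  -- (K + 1)` makes `δ K < 1` for uniqueness.
  set ε' := min (ε / 2) (min R (1 / (K + 1))) with hε'
  have hε'0 : 0 < ε' := by positivity
  have hε'ε : ε' ≤ ε / 2 := min_le_left _ _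
  have hε'R : ε' ≤ R := (min_le_right _ _).trans (min_le_left _ _)
  have hε'K : ε' * (K + 1) ≤ 1 := by
    have : ε' ≤ 1 / (K + 1) := (min_le_right _ _).trans (min_le_right _ _)
    rwa [le_div_iff₀ (by positivity)] at this
  refine ⟨ball p ε', ball_mem_nhds p hε'0, 1 / (2 * R) + 1 / r, by positivity, ?_⟩
  rintro z ⟨hzΩ, hzp⟩
  have hδ : 0 < boundaryDist Ω z := by
    refine (isClosed_frontier.notMem_iff_infDist_pos ⟨p, hp⟩).1 fun hz => ?_
    rw [hΩ_open.frontier_eq] at hz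
    exact hz.2 hzΩ
  have hδε : boundaryDist Ω z < ε' := (infDist_le_dist_of_mem hp).trans_lt hzp
  have hnear : ∀ q, dist z q = boundaryDist Ω z → q ∈ ball p ε := fun q hq => by
    have := dist_triangle_left q p z
    rw [mem_ball] at hzp ⊢
    linarith
  have hfoot : ∀ q, IsFootPoint Ω W ρ z q → q ∈ ball p ε := by
    rintro q ⟨hq, hqW, hz⟩
    refine hnear q ?_
    have hν := norm_innerNormal (hρ.fderiv_ne_zero q hqW
      (hρ.eq_zero_of_mem_frontier hΩ_open hq hqW))
    rw [dist_eq_norm]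
    nth_rewrite 1 [hz]
    rw [add_sub_cancel_left, norm_smul, hν, mul_one, Real.norm_eq_abs, abs_of_pos hδ]
  refine ⟨?_, fun q hq X => ?_⟩
  · obtain ⟨q, hq, hzq⟩ := isClosed_frontier.exists_infDist_eq_dist ⟨p, hp⟩ z
    have hqε := hnear q hzq.symm
    obtain ⟨hne, hH, -⟩ := hgeo q hq hqε
    have hqf : IsFootPoint Ω W ρ z q := ⟨hq, hεW hqε,
      eq_add_boundaryDist_smul hΩ_open hzΩ hδ hzq (norm_innerNormal hne) hH⟩
    refine ⟨q, hqf, fun q' hq' => ?_⟩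
    have hlip := hK.norm_sub_le hqε (hfoot q' hq')
    -- Two foot points differ by `δ` times the difference of their normals; the Lipschitz bound with
    -- `δ K < 1` then forces them to coincide.
    have heq : q' - q = boundaryDist Ω z • (innerNormal ρ q - innerNormal ρ q') := by
      rw [smul_sub, sub_eq_sub_iff_add_eq_add, ← hq'.2.2, add_comm, ← hqf.2.2]
    have hnorm : ‖q' - q‖ ≤ boundaryDist Ω z * (K * ‖q' - q‖) := by
      calc ‖q' - q‖ = boundaryDist Ω z * ‖innerNormal ρ q - innerNormal ρ q'‖ := by
            rw [heq, norm_smul, Real.norm_eq_abs, abs_of_pos hδ]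
        _ ≤ boundaryDist Ω z * (K * ‖q' - q‖) := by
            rw [norm_sub_rev q' q]; gcongr
    rw [← sub_eq_zero, ← norm_eq_zero]
    by_contra hne0
    have hpos : 0 < ‖q' - q‖ := (norm_nonneg _).lt_of_ne' hne0
    have h1 : boundaryDist Ω z * K < 1 := by nlinarith [K.2]
    nlinarith
  · obtain ⟨hne, hH, hB⟩ := hgeo q hq.1 (hfoot q hq)
    have hν := norm_innerNormal hne
    obtain ⟨t, φ, hφ, hφm, hφ0, hφX, ht⟩ := exists_disc_competitor hν hδ (hδε.le.trans hε'R) hr hB X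
    obtain ⟨f, hf, hfm, hfX⟩ := exists_halfSpace_competitor hν hδ fun w hw => by
      rw [← EuclideanSpace.inner_real_eq_re]; exact hH w hw
    rw [← hq.2.2] at hφ0 hfX
    have h1 := le_caratheodoryMetric hΩ_open hφ hφm hφ0 hφX hf hfm
    have h2 := le_kobayashiMetric hΩ_open hφ hφm hφ0 hφX hf hfm
    have h3 := caratheodoryMetric_le hΩ_open hφ hφm hφ0 hφX
    have h4 := kobayashiMetric_le hφ hφm hφ0 hφX
    rw [hfX] at h1 h2
    rw [norm_normalComponent hne]
    refine ⟨⟨?_, ?_⟩, ?_, ?_⟩ <;> linarith
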